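/- Let $X$ be a Tychonoff space. Let $F(X)$ and $A(X)$ be the free topological group and the free Abelian topological group over $X$, i.e. the abstract free group, respectively free Abelian group, on the set $X$ with the finest group topology making the inclusion of $X$ continuous. For $n \ge 1$ let $F_n(X) \subseteq F(X)$ and $A_n(X) \subseteq A(X)$ be the subspaces of all elements of reduced length at most $n$ with respect to the basis $X$. A sequence is non-trivial if it is not eventually constant. A set $P \subseteq Z$ is a sequential neighborhood of a point $z$ of a space $Z$ if every sequence converging to $z$ is eventually in $P$. A space $Z$ is $snf$-countable if to each $z \in Z$ one can assign a countable family $\mathcal P_z$ of sequential neighborhoods of $z$ such that for all $U, V \in \mathcal P_z$ there is $W \in \mathcal P_z$ with $W \subseteq U \cap V$, and for every open $U \ni z$ there is $P \in \mathcal P_z$ with $z \in P \subseteq U$. Then, for $(G(X), (G_n(X))_{n\ge1})$ equal to $(F(X), (F_n(X))_{n\ge1})$, and likewise for it equal to $(A(X), (A_n(X))_{n\ge1})$, the following statements are equivalent: (i) $G(X)$ is $snf$-countable. (ii) For every $n \ge 1$, the subspace $G_n(X)$ contains no non-trivial convergent sequence. (iii) $G(X)$ contains no non-trivial convergent sequence.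 -/

import Mathlib

open Filter Topology

section Networks

variable {Z : Type*} [TopologicalSpace Z]

/-- `P` is a sequential neighbourhood of `z`: each sequence converging to `z` is eventually
in `P`. -/
def IsSequentialNhd (P : Set Z) (z : Z) : Prop :=
  ∀ u : ℕ → Z, Tendsto u atTop (𝓝 z) → ∀ᶠ n in atTop, u n ∈ P

/-- `⋃ z, N z` is an sn-network for `Z`, decomposed into the local families `N z`. -/
structure IsSnNetwork (N : Z → Set (Set Z)) : Prop where
  cover : ⋃ z, ⋃₀ N z = Set.univ
  inter : ∀ z, ∀ U ∈ N z, ∀ V ∈ N z, ∃ W ∈ N z, W ⊆ U ∩ V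
  network : ∀ z, ∀ U : Set Z, IsOpen U → z ∈ U → ∃ P ∈ N z, z ∈ P ∧ P ⊆ U
  sequentialNhd : ∀ z, ∀ P ∈ N z, IsSequentialNhd P z

variable (Z)

/-- `Z` is snf-countable: it has an sn-network whose local families are all countable. -/
def SnfCountable : Prop :=
  ∃ N : Z → Set (Set Z), IsSnNetwork N ∧ ∀ z, (N z).Countable

/-- `Z` contains a non-trivial convergent sequence, i.e. a convergent sequence that is not
eventually constant. (In a T₁ space this is the same as having a convergent sequence
with infinitely many distinct terms.) -/
def HasNontrivialConvergentSeq : Prop :=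
  ∃ (u : ℕ → Z) (z : Z), Tendsto u atTop (𝓝 z) ∧ ¬ EventuallyConst u atTop

end Networks

section FreeGroups

variable (X : Type*) [TopologicalSpace X]

/-- The free topological group `F(X)`: the abstract free group on `X` with the finest group
topology for which the inclusion of `X` is continuous. -/
instance freeTopologicalGroupTopology : TopologicalSpace (FreeGroup X) :=
  (GroupTopology.coinduced (FreeGroup.of : X → FreeGroup X)).toTopologicalSpace

instance freeTopologicalGroup_isTopologicalGroup : IsTopologicalGroup (FreeGroup X) :=
  (GroupTopology.coinduced (FreeGroup.of : X → FreeGroup X)).toIsTopologicalGroup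

/-- The free Abelian topological group `A(X)`: the abstract free Abelian group on `X` with the
finest group topology for which the inclusion of `X` is continuous. -/
instance freeAbelianTopologicalGroupTopology : TopologicalSpace (FreeAbelianGroup X) :=
  (AddGroupTopology.coinduced (FreeAbelianGroup.of : X → FreeAbelianGroup X)).toTopologicalSpace

instance freeAbelianTopologicalGroup_isTopologicalAddGroup :
    IsTopologicalAddGroup (FreeAbelianGroup X) :=
  (AddGroupTopology.coinduced
    (FreeAbelianGroup.of : X → FreeAbelianGroup X)).toIsTopologicalAddGroup

variable {X}

/-- The inclusion of `X` into `F(X)` is continuous. -/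
theorem continuous_freeGroup_of : Continuous (FreeGroup.of : X → FreeGroup X) :=
  GroupTopology.coinduced_continuous _

/-- The inclusion of `X` into `A(X)` is continuous. -/
theorem continuous_freeAbelianGroup_of :
    Continuous (FreeAbelianGroup.of : X → FreeAbelianGroup X) :=
  AddGroupTopology.coinduced_continuous _

/-- The universal property of `F(X)`. -/
theorem continuous_freeGroup_lift {G : Type*} [Group G] [TopologicalSpace G]
    [IsTopologicalGroup G] {f : X → G} (hf : Continuous f) :
    Continuous (FreeGroup.lift f) := by
  let T : GroupTopology (FreeGroup X) :=
    { toTopologicalSpace := TopologicalSpace.induced (FreeGroup.lift f) inferInstance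
      toIsTopologicalGroup := topologicalGroup_induced (FreeGroup.lift f) }
  have h : GroupTopology.coinduced (FreeGroup.of : X → FreeGroup X) ≤ T := by
    refine sInf_le ?_
    change TopologicalSpace.coinduced _ _ ≤ TopologicalSpace.induced _ _
    rw [← continuous_iff_coinduced_le, continuous_induced_rng]
    exact hf.congr fun x => by simp
  exact continuous_iff_le_induced.2 h

/-- The universal property of `A(X)`. -/
theorem continuous_freeAbelianGroup_lift {G : Type*} [AddCommGroup G] [TopologicalSpace G]
    [IsTopologicalAddGroup G] {f : X → G} (hf : Continuous f) :
    Continuous (FreeAbelianGroup.lift f) := by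
  let T : AddGroupTopology (FreeAbelianGroup X) :=
    { toTopologicalSpace := TopologicalSpace.induced (FreeAbelianGroup.lift f) inferInstance
      toIsTopologicalAddGroup := topologicalAddGroup_induced (FreeAbelianGroup.lift f) }
  have h : AddGroupTopology.coinduced (FreeAbelianGroup.of : X → FreeAbelianGroup X) ≤ T := by
    refine sInf_le ?_
    change TopologicalSpace.coinduced _ _ ≤ TopologicalSpace.induced _ _
    rw [← continuous_iff_coinduced_le, continuous_induced_rng]
    exact hf.congr fun x => by simp
  exact continuous_iff_le_induced.2 h

end FreeGroups

open Classical in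
/-- `F_n(X)`: the elements of `F(X)` of reduced length at most `n`. -/
def freeGroupBall (X : Type*) (n : ℕ) : Set (FreeGroup X) :=
  {g | g.toWord.length ≤ n}

/-- `A_n(X)`: the elements `∑ kₓ x` of `A(X)` of reduced length `∑ |kₓ|` at most `n`. -/
def freeAbelianGroupBall (X : Type*) (n : ℕ) : Set (FreeAbelianGroup X) :=
  {g | (FreeAbelianGroup.toFinsupp g).sum (fun _ k => k.natAbs) ≤ n}

/-!
The point is that the reduced length is bounded along every convergent sequence of `F(X)` and of
`A(X)`; the rest is formal. Bounded length puts a convergent sequence inside a single ball, which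
compares the balls with the whole group (`not_hasNontrivialConvergentSeq_of_balls`). It also
excludes non-trivial convergent sequences `u k → 1` when the group is snf-countable: a diagonal
choice of powers `u (k m) ^ m` still converges to `1`, while the length of the `m`-th power of a
nontrivial element is at least `m` (`not_hasNontrivialConvergentSeq_of_snfCountable`). Conversely,
without non-trivial convergent sequences the singletons are sequential neighbourhoods.

For `A(X)`, an element `∑ kₓ x` is a finitely supported measure on `X`, whose norm as a functional
on the bounded continuous functions is its length `∑ |kₓ|`. A convergent sequence of elements is
pointwise convergent as a sequence of functionals, so its lengths are bounded by the
Banach–Steinhaus theorem (`bddAbove_length_of_tendsto_freeAbelianGroup`).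

For `F(X)`, length is turned into the degree of a polynomial. Let `S` be the ring of real
`2 × 2` matrices and give `S[T]` the box topology on coefficients, a ring topology in which
convergent sequences have bounded degree (`Polynomial.bddAbove_natDegree_of_tendsto_box`). For a
continuous `s : X → (0, ∞)` let `a x` and `b x` be the projections of the plane onto the orthogonal
lines through `(1, s x)` and `(-s x, 1)`, and `c x` the reflection that interchanges these lines.
Then `1 + c x T + a x T²` is a unit with inverse `1 - c x T + b x T²`, it depends continuously on
`x`, and so it defines a continuous homomorphism from `F(X)` to the units of `S[T]`. On a word of
length `n` the coefficient of `T ^ (2 n)` is a product of projections onto lines, which does not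
vanish if consecutive lines are not orthogonal; for a reduced word this holds when `s` is injective
on its letters. One function `s` that separates the countably many letters of a given sequence
exists by the Baire category theorem (`exists_boundedContinuousFunction_injOn`).
-/

/-! ### Convergent sequences in groups with a length function -/

section PowerTrick

variable {G : Type*}

theorem hasNontrivialConvergentSeq_of_subtype [TopologicalSpace G] {S : Set G}
    (h : HasNontrivialConvergentSeq S) : HasNontrivialConvergentSeq G := by
  obtain ⟨u, z, hu, hc⟩ := h
  refine ⟨fun n => (u n : G), z, (continuous_subtype_val.tendsto z).comp hu, fun h => hc ?_⟩
  rw [eventuallyConst_atTop] at h ⊢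
  obtain ⟨i, hi⟩ := h
  exact ⟨i, fun j hj => Subtype.ext (hi j hj)⟩

theorem snfCountable_of_not_hasNontrivialConvergentSeq [TopologicalSpace G]
    (h : ¬ HasNontrivialConvergentSeq G) : SnfCountable G := by
  refine ⟨fun z => {{z}}, ⟨?_, ?_, ?_, ?_⟩, fun z => Set.countable_singleton _⟩
  · exact Set.eq_univ_of_forall fun z => Set.mem_iUnion.2 ⟨z, {z}, rfl, rfl⟩
  · rintro z U rfl V rfl
    exact ⟨{z}, rfl, by simp⟩
  · intro z U _ hz
    exact ⟨{z}, rfl, rfl, by simpa using hz⟩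
  · rintro z P rfl u hu
    by_contra hne
    have hfreq : ∃ᶠ n in atTop, u n ≠ z := by simpa [Filter.Frequently] using hne
    -- Interleaving `u` with the constant sequence `z` prevents eventual constancy at a
    -- point other than `z`, which is needed because `G` is not assumed to be T₁.
    refine h ⟨fun n => if Even n then z else u (n / 2), z, ?_, ?_⟩
    · have h2 : Tendsto (fun n => u (n / 2)) atTop (𝓝 z) :=
        hu.comp (Nat.tendsto_div_const_atTop two_ne_zero)
      exact (tendsto_const_nhds (x := z)).if' h2
    · rw [eventuallyConst_atTop]
      rintro ⟨i, hi⟩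
      obtain ⟨n, hn, hnz⟩ := frequently_atTop.1 hfreq i
      have h1 := hi (2 * n + 1) (by omega)
      have h2 := hi (2 * n) (by omega)
      rw [← h2] at h1
      have e : (2 * n + 1) / 2 = n := by omega
      simp [e] at h1
      exact hnz h1

/-- A length function `ℓ` that is bounded along convergent sequences confines each of them to a
single ball. -/
theorem not_hasNontrivialConvergentSeq_of_balls [TopologicalSpace G] {ℓ : G → ℕ}
    (hℓ : ∀ (u : ℕ → G) (z : G), Tendsto u atTop (𝓝 z) → BddAbove (Set.range fun k => ℓ (u k)))
    (h : ∀ n : ℕ, 1 ≤ n → ¬ HasNontrivialConvergentSeq {g : G | ℓ g ≤ n}) :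
    ¬ HasNontrivialConvergentSeq G := by
  rintro ⟨u, z, hu, hc⟩
  obtain ⟨B, hB⟩ := hℓ u z hu
  refine h (B + ℓ z + 1) (by omega) ⟨fun k => ⟨u k, ?_⟩, ⟨z, ?_⟩, ?_, fun h => hc ?_⟩
  · have : ℓ (u k) ≤ B := hB ⟨k, rfl⟩
    change ℓ (u k) ≤ _
    omega
  · change ℓ z ≤ _
    omega
  · exact tendsto_subtype_rng.2 hu
  · exact h.comp Subtype.val

/-- If `P 0, P 1, …` are countably many sequential neighbourhoods that form a network at `1` and
`u k → 1` is non-trivial, then `u k ^ m → 1` for each `m`, so some `(u (k m)) ^ m` with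
`u (k m) ≠ 1` lies in `P 0, …, P m`. These powers converge to `1` although their lengths are at
least `m`. -/
@[to_additive not_hasNontrivialConvergentSeq_of_snfCountable_add]
theorem not_hasNontrivialConvergentSeq_of_snfCountable [Group G] [TopologicalSpace G]
    [IsTopologicalGroup G] {ℓ : G → ℕ}
    (hℓ : ∀ (u : ℕ → G) (z : G), Tendsto u atTop (𝓝 z) → BddAbove (Set.range fun k => ℓ (u k)))
    (hpow : ∀ (g : G) (m : ℕ), g ≠ 1 → m ≤ ℓ (g ^ m)) (h : SnfCountable G) :
    ¬ HasNontrivialConvergentSeq G := by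
  rintro ⟨u, z, hu, hc⟩
  obtain ⟨N, hN, hcount⟩ := h
  obtain ⟨P₀, hP₀, -⟩ := hN.network 1 Set.univ isOpen_univ trivial
  obtain ⟨Q, hQ⟩ := (hcount 1).exists_eq_range ⟨P₀, hP₀⟩
  have hv : Tendsto (fun k => z⁻¹ * u k) atTop (𝓝 1) := by
    simpa using hu.const_mul z⁻¹
  have hfreq : ∃ᶠ k in atTop, z⁻¹ * u k ≠ 1 := fun hev => hc <| by
    refine eventuallyConst_iff_exists_eventuallyEq.2 ⟨z, hev.mono fun k hk => ?_⟩
    exact (inv_mul_eq_one.1 (not_not.1 hk)).symm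
  have hchoose : ∀ m : ℕ, ∃ k, z⁻¹ * u k ≠ 1 ∧ ∀ i ≤ m, (z⁻¹ * u k) ^ m ∈ Q i := by
    intro m
    have hm : Tendsto (fun k => (z⁻¹ * u k) ^ m) atTop (𝓝 1) := by
      simpa using hv.pow m
    have hall : ∀ᶠ k in atTop, ∀ i ∈ Set.Iic m, (z⁻¹ * u k) ^ m ∈ Q i :=
      (eventually_all_finite (Set.finite_Iic m)).2 fun i _ =>
        hN.sequentialNhd 1 (Q i) (hQ ▸ ⟨i, rfl⟩) _ hm
    exact (hfreq.and_eventually hall).exists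
  choose k hk1 hkQ using hchoose
  have hw : Tendsto (fun m => (z⁻¹ * u (k m)) ^ m) atTop (𝓝 1) := by
    refine tendsto_nhds.2 fun U hU h1 => ?_
    obtain ⟨P, hP, -, hPU⟩ := hN.network 1 U hU h1
    rw [hQ] at hP
    obtain ⟨i, rfl⟩ := hP
    exact (eventually_ge_atTop i).mono fun m hm => hPU (hkQ m i hm)
  obtain ⟨B, hB⟩ := hℓ _ _ hw
  have h1 : ℓ ((z⁻¹ * u (k (B + 1))) ^ (B + 1)) ≤ B := hB ⟨B + 1, rfl⟩
  have h2 := hpow _ (B + 1) (hk1 (B + 1))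
  omega

end PowerTrick

/-! ### The box topology on a polynomial ring -/

section BoxTopology

open Polynomial

variable {S : Type*} [NormedRing S]

/-- The polynomials whose `n`-th coefficient has norm less than `ε n` for each `n`. -/
def Polynomial.coeffBox (S : Type*) [NormedRing S] (ε : ℕ → ℝ) : Set S[X] :=
  {p | ∀ n, ‖p.coeff n‖ < ε n}

theorem exists_pos_forall_le_of_forall_pos {η : ℕ → ℝ} (hη : ∀ n, 0 < η n) (b : ℕ → ℕ) :
    ∃ δ : ℕ → ℝ, (∀ m, 0 < δ m) ∧ ∀ m, ∀ n ≤ b m, δ m ≤ η n := by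
  refine ⟨fun m => (Finset.range (b m + 1)).inf' ⟨0, by simp⟩ η, fun m => ?_, fun m n hn => ?_⟩
  · exact (Finset.lt_inf'_iff _).2 fun i _ => hη i
  · exact Finset.inf'_le _ (by simp; omega)

theorem norm_coeff_mul_lt {p q : S[X]} {n : ℕ} {c : ℝ}
    (h : ∀ i j, i + j = n → ‖p.coeff i‖ * ‖q.coeff j‖ < c / (n + 1)) :
    ‖(p * q).coeff n‖ < c := by
  rw [coeff_mul]
  calc ‖∑ x ∈ Finset.HasAntidiagonal.antidiagonal n, p.coeff x.1 * q.coeff x.2‖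
      ≤ ∑ x ∈ Finset.HasAntidiagonal.antidiagonal n, ‖p.coeff x.1 * q.coeff x.2‖ := norm_sum_le _ _
    _ < ∑ _x ∈ Finset.HasAntidiagonal.antidiagonal n, c / (n + 1) := by
        refine Finset.sum_lt_sum_of_nonempty ⟨(0, n), by simp⟩ fun x hx => ?_
        exact (norm_mul_le _ _).trans_lt (h _ _ (Finset.HasAntidiagonal.mem_antidiagonal.1 hx))
    _ = c := by
        rw [Finset.sum_const, Finset.Nat.card_antidiagonal, nsmul_eq_mul]
        push_cast
        field_simp

theorem exists_norm_coeff_lt (p : S[X]) : ∃ C : ℝ, 0 < C ∧ ∀ i, ‖p.coeff i‖ < C := by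
  refine ⟨∑ i ∈ p.support, ‖p.coeff i‖ + 1, by positivity, fun i => ?_⟩
  by_cases hi : i ∈ p.support
  · have := Finset.single_le_sum (f := fun i => ‖p.coeff i‖) (fun _ _ => norm_nonneg _) hi
    linarith
  · rw [notMem_support_iff.1 hi, norm_zero]
    positivity

/-- The boxes `coeffBox S ε` form a basis of neighbourhoods of zero for a ring topology on `S[X]`:
the box topology on sequences of coefficients. -/
@[reducible]
def Polynomial.boxBasis (S : Type*) [NormedRing S] : RingFilterBasis S[X] where
  sets := {U | ∃ ε : ℕ → ℝ, (∀ n, 0 < ε n) ∧ U = coeffBox S ε}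
  nonempty := ⟨_, fun _ => 1, fun _ => one_pos, rfl⟩
  inter_sets := by
    rintro _ _ ⟨ε, hε, rfl⟩ ⟨δ, hδ, rfl⟩
    exact ⟨_, ⟨fun n => min (ε n) (δ n), fun n => lt_min (hε n) (hδ n), rfl⟩,
      fun p hp => ⟨fun n => (hp n).trans_le (min_le_left _ _),
        fun n => (hp n).trans_le (min_le_right _ _)⟩⟩
  zero' := by
    rintro _ ⟨ε, hε, rfl⟩ n
    simpa using hε n
  add' := by
    rintro _ ⟨ε, hε, rfl⟩
    refine ⟨_, ⟨fun n => ε n / 2, fun n => half_pos (hε n), rfl⟩, ?_⟩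
    rintro _ ⟨p, hp, q, hq, rfl⟩ n
    have h1 := hp n
    have h2 := hq n
    simp only [coeff_add]
    linarith [norm_add_le (p.coeff n) (q.coeff n)]
  neg' := by
    rintro _ ⟨ε, hε, rfl⟩
    exact ⟨_, ⟨ε, hε, rfl⟩, fun p hp n => by simpa using hp n⟩
  conj' := by
    rintro x _ ⟨ε, hε, rfl⟩
    exact ⟨_, ⟨ε, hε, rfl⟩, fun p hp n => by simpa using hp n⟩
  mul' := by
    rintro _ ⟨ε, hε, rfl⟩
    -- If `i + j = n` and `m = max i j`, then `n ≤ 2 * m`.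
    obtain ⟨δ, hδ, hδε⟩ := exists_pos_forall_le_of_forall_pos
      (η := fun n => ε n / (n + 1)) (fun n => div_pos (hε n) (by positivity)) (fun m => 2 * m)
    refine ⟨_, ⟨fun m => min (δ m) 1, fun m => lt_min (hδ m) one_pos, rfl⟩, ?_⟩
    rintro _ ⟨p, hp, q, hq, rfl⟩ n
    refine norm_coeff_mul_lt fun i j hij => ?_
    have hp' := lt_min_iff.1 (hp i)
    have hq' := lt_min_iff.1 (hq j)
    rcases le_total i j with h | h
    · refine lt_of_le_of_lt (mul_le_of_le_one_left (norm_nonneg _) hp'.2.le) ?_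
      exact hq'.1.trans_le (hδε j n (by omega))
    · refine lt_of_le_of_lt (mul_le_of_le_one_right (norm_nonneg _) hq'.2.le) ?_
      exact hp'.1.trans_le (hδε i n (by omega))
  mul_left' := by
    rintro x _ ⟨ε, hε, rfl⟩
    obtain ⟨C, hC, hxC⟩ := exists_norm_coeff_lt x
    obtain ⟨δ, hδ, hδε⟩ := exists_pos_forall_le_of_forall_pos
      (η := fun n => ε n / (n + 1) / C) (fun n => div_pos (div_pos (hε n) (by positivity)) hC)
      (fun m => m + x.natDegree)
    refine ⟨_, ⟨δ, hδ, rfl⟩, fun p hp n => norm_coeff_mul_lt fun i j hij => ?_⟩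
    by_cases hi : i ≤ x.natDegree
    · calc ‖x.coeff i‖ * ‖p.coeff j‖ ≤ C * ‖p.coeff j‖ := by gcongr; exact (hxC i).le
        _ < C * (ε n / (n + 1) / C) := by
            gcongr
            exact (hp j).trans_le (hδε j n (by omega))
        _ = ε n / (n + 1) := by field_simp
    · rw [coeff_eq_zero_of_natDegree_lt (not_le.1 hi), norm_zero, zero_mul]
      exact div_pos (hε n) (by positivity)
  mul_right' := by
    rintro x _ ⟨ε, hε, rfl⟩
    obtain ⟨C, hC, hxC⟩ := exists_norm_coeff_lt x
    obtain ⟨δ, hδ, hδε⟩ := exists_pos_forall_le_of_forall_pos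
      (η := fun n => ε n / (n + 1) / C) (fun n => div_pos (div_pos (hε n) (by positivity)) hC)
      (fun m => m + x.natDegree)
    refine ⟨_, ⟨δ, hδ, rfl⟩, fun p hp n => norm_coeff_mul_lt fun i j hij => ?_⟩
    by_cases hj : j ≤ x.natDegree
    · calc ‖p.coeff i‖ * ‖x.coeff j‖ ≤ ‖p.coeff i‖ * C := by gcongr; exact (hxC j).le
        _ < (ε n / (n + 1) / C) * C := by
            gcongr
            exact (hp i).trans_le (hδε i n (by omega))
        _ = ε n / (n + 1) := by field_simp
    · rw [coeff_eq_zero_of_natDegree_lt (not_le.1 hj), norm_zero, mul_zero]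
      exact div_pos (hε n) (by positivity)

theorem Polynomial.coeffBox_mem_nhds_zero {ε : ℕ → ℝ} (hε : ∀ n, 0 < ε n) :
    coeffBox S ε ∈ @nhds _ (boxBasis S).topology 0 :=
  (boxBasis S).toAddGroupFilterBasis.mem_nhds_zero ⟨ε, hε, rfl⟩

theorem Polynomial.continuous_C_box :
    @Continuous S S[X] _ (boxBasis S).topology C := by
  let _ := (boxBasis S).topology
  have := (boxBasis S).isTopologicalRing
  refine continuous_of_continuousAt_zero (C : S →+* S[X]) ?_
  rw [ContinuousAt, map_zero,
    (boxBasis S).toAddGroupFilterBasis.nhds_zero_hasBasis.tendsto_right_iff]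
  rintro _ ⟨ε, hε, rfl⟩
  filter_upwards [Metric.ball_mem_nhds (0 : S) (hε 0)] with s hs n
  rcases n with _ | n
  · simpa using hs
  · simpa [coeff_C] using hε (n + 1)

/-- Convergent sequences in the box topology have bounded degree: given polynomials `q k` of
unbounded degree, a box can be chosen that excludes infinitely many of them by their leading
coefficients. -/
theorem Polynomial.bddAbove_natDegree_of_tendsto_box {u : ℕ → S[X]} {z : S[X]}
    (hu : Tendsto u atTop (@nhds _ (boxBasis S).topology z)) :
    BddAbove (Set.range fun k => (u k).natDegree) := by
  let _ := (boxBasis S).topology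
  have := (boxBasis S).isTopologicalRing
  have hq : Tendsto (fun k => u k - z) atTop (𝓝 0) := by
    simpa using hu.sub_const z
  by_contra hb
  have hb' : ¬ BddAbove (Set.range fun k => (u k - z).natDegree) := by
    rintro ⟨B, hB⟩
    refine hb ⟨max B z.natDegree, ?_⟩
    rintro _ ⟨k, rfl⟩
    have h1 : (u k - z).natDegree ≤ B := hB ⟨k, rfl⟩
    calc (u k).natDegree = ((u k - z) + z).natDegree := by rw [sub_add_cancel]
      _ ≤ max (u k - z).natDegree z.natDegree := natDegree_add_le _ _
      _ ≤ _ := max_le_max h1 le_rfl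
  -- If `n` occurs among the degrees of the differences, the `n`-th side of the box is a leading
  -- coefficient of that degree.
  have hε : ∀ n : ℕ, ∃ ε : ℝ, 0 < ε ∧ ((∃ k, (u k - z).natDegree = n ∧ u k - z ≠ 0) →
      ∃ k, (u k - z).natDegree = n ∧ ε ≤ ‖(u k - z).coeff n‖) := by
    intro n
    by_cases h : ∃ k, (u k - z).natDegree = n ∧ u k - z ≠ 0
    · obtain ⟨k, hk, hk0⟩ := h
      refine ⟨‖(u k - z).coeff n‖, ?_, fun _ => ⟨k, hk, le_rfl⟩⟩
      rw [norm_pos_iff, ← hk]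
      exact leadingCoeff_ne_zero.2 hk0
    · exact ⟨1, one_pos, fun h' => absurd h' h⟩
  choose ε hε0 hε using hε
  obtain ⟨K, hK⟩ := eventually_atTop.1 (hq.eventually (coeffBox_mem_nhds_zero hε0))
  refine hb' ⟨∑ k ∈ Finset.range K, (u k - z).natDegree, ?_⟩
  rintro _ ⟨k, rfl⟩
  by_contra! hlt
  obtain ⟨k', hk', hle⟩ := hε _ ⟨k, rfl, fun h0 => by simp [h0] at hlt⟩
  rcases lt_or_ge k' K with h | h
  · have := Finset.single_le_sum (f := fun k => (u k - z).natDegree) (fun _ _ => Nat.zero_le _)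
      (Finset.mem_range.2 h)
    omega
  · exact absurd (hK k' h _) (not_lt.2 hle)

end BoxTopology

/-! ### Powers in a free group -/

section FreeGroupWords

variable {X : Type*}

/-- In the reduced word of `g ^ m` the cyclic reduction of `g`, which is nonempty, occurs `m` times
between a conjugator and its inverse. -/
theorem FreeGroup.le_length_toWord_pow [DecidableEq X] (g : FreeGroup X) (m : ℕ) (hg : g ≠ 1) :
    m ≤ (g ^ m).toWord.length := by
  rcases m with _ | m
  · exact Nat.zero_le _
  have hne : reduceCyclically g.toWord ≠ [] := fun h => hg <| by
    have := reduceCyclically.conj_conjugator_reduceCyclically g.toWord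
    rw [h, List.append_nil] at this
    rw [← FreeGroup.mk_toWord (x := g), ← this, ← FreeGroup.mul_mk, ← FreeGroup.inv_mk,
      mul_inv_cancel]
  have hpos : 1 ≤ (reduceCyclically g.toWord).length := List.length_pos_iff.2 hne
  rw [FreeGroup.toWord_pow,
    reduceCyclically.reduce_flatten_replicate_succ FreeGroup.isReduced_toWord]
  simp only [List.length_append, List.length_flatten, List.map_replicate, List.sum_replicate,
    smul_eq_mul]
  nlinarith

end FreeGroupWords

/-! ### Quadratic units -/

section QuadraticUnits

variable {R : Type*} [Ring R]

/-- The product of two quadratic polynomials in an element `t` that commutes with `b` and `c`,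
expanded: the coefficients of `t`, `t²`, `t³` and `t⁴` vanish by the relations between
`a`, `b` and `c`. -/
theorem quadratic_mul_eq_one {a b c t : R} (htb : Commute t b)
    (htc : Commute t c) (hcc : c * c = a + b) (hcb : c * b = a * c) (hab : a * b = 0) :
    (1 + c * t + a * t ^ 2) * (1 - c * t + b * t ^ 2) = 1 := by
  have eb : ∀ y, t * (b * y) = b * (t * y) := fun y => by rw [← mul_assoc, htb.eq, mul_assoc]
  have ec : ∀ y, t * (c * y) = c * (t * y) := fun y => by rw [← mul_assoc, htc.eq, mul_assoc]
  have fcc : ∀ y, c * (c * y) = a * y + b * y := fun y => by rw [← mul_assoc, hcc, add_mul]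
  have fcb : ∀ y, c * (b * y) = a * (c * y) := fun y => by rw [← mul_assoc, hcb, mul_assoc]
  have fab : ∀ y, a * (b * y) = 0 := fun y => by rw [← mul_assoc, hab, zero_mul]
  simp only [pow_two, mul_add, add_mul, mul_sub, mul_one, one_mul, mul_assoc, eb, ec, fcc, fcb,
    fab]
  abel

end QuadraticUnits

/-! ### A polynomial representation of the free group -/

section Representation

open Polynomial

variable {X S : Type*} [NormedRing S]

/-- The unit `1 + c T + a T²` of `S[T]`, with inverse `1 - c T + b T²`. -/
noncomputable def Polynomial.quadraticUnit (a b c : S) (hcc : c * c = a + b) (hcb : c * b = a * c)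
    (hca : c * a = b * c) (hab : a * b = 0) (hba : b * a = 0) : S[X]ˣ where
  val := 1 + C c * Polynomial.X + C a * Polynomial.X ^ 2
  inv := 1 - C c * Polynomial.X + C b * Polynomial.X ^ 2
  val_inv := quadratic_mul_eq_one (commute_X _) (commute_X _)
    (by rw [← C_mul, hcc, C_add]) (by rw [← C_mul, hcb, C_mul]) (by rw [← C_mul, hab, C_0])
  inv_val := by
    have := quadratic_mul_eq_one (a := C b) (b := C a) (c := - C c) (commute_X _)
      (commute_X _).neg_right (by rw [neg_mul_neg, ← C_mul, hcc, C_add, add_comm])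
      (by rw [neg_mul, mul_neg, ← C_mul, hca, C_mul]) (by rw [← C_mul, hba, C_0])
    simpa only [neg_mul, sub_neg_eq_add, ← sub_eq_add_neg] using this

theorem Polynomial.natDegree_quadraticUnit_le (c a : S) :
    (1 + C c * Polynomial.X + C a * Polynomial.X ^ 2).natDegree ≤ 2 := by
  compute_degree

theorem Polynomial.coeff_two_quadraticUnit (c a : S) :
    (1 + C c * Polynomial.X + C a * Polynomial.X ^ 2).coeff 2 = a := by
  simp [coeff_one]

/-- If every letter `x` is sent to the unit `1 + c x T + a x T²`, whose inverse has the leading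
coefficient `b x`, then a word of length `n` has degree `2 * n` unless the product of the leading
coefficients of its letters vanishes. So lengths are bounded along convergent sequences. -/
theorem bddAbove_length_of_quadraticUnit [TopologicalSpace X] [DecidableEq X] {a b c : X → S}
    (ha : Continuous a) (hb : Continuous b) (hc : Continuous c)
    (hcc : ∀ x, c x * c x = a x + b x) (hcb : ∀ x, c x * b x = a x * c x)
    (hca : ∀ x, c x * a x = b x * c x) (hab : ∀ x, a x * b x = 0) (hba : ∀ x, b x * a x = 0)
    {u : ℕ → FreeGroup X} {z : FreeGroup X} (hu : Tendsto u atTop (𝓝 z))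
    (hprod : ∀ k, ((u k).toWord.map fun p => cond p.2 (a p.1) (b p.1)).prod ≠ 0) :
    BddAbove (Set.range fun k => (u k).toWord.length) := by
  let _ := (boxBasis S).topology
  have := (boxBasis S).isTopologicalRing
  let φ : X → S[X]ˣ := fun x =>
    quadraticUnit (a x) (b x) (c x) (hcc x) (hcb x) (hca x) (hab x) (hba x)
  have hC : Continuous (C : S → S[X]) := continuous_C_box
  have hφ : Continuous φ := by
    rw [Units.continuous_iff]
    exact ⟨(continuous_const.add ((hC.comp hc).mul continuous_const)).add
        ((hC.comp ha).mul continuous_const),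
      (continuous_const.sub ((hC.comp hc).mul continuous_const)).add
        ((hC.comp hb).mul continuous_const)⟩
  have hlim : Tendsto (fun k => ((FreeGroup.lift φ (u k) : S[X]ˣ) : S[X])) atTop
      (𝓝 (FreeGroup.lift φ z : S[X]ˣ)) :=
    ((Units.continuous_val.comp (continuous_freeGroup_lift hφ)).tendsto z).comp hu
  obtain ⟨B, hB⟩ := bddAbove_natDegree_of_tendsto_box hlim
  refine ⟨B, ?_⟩
  rintro _ ⟨k, rfl⟩
  have hBk : ((FreeGroup.lift φ (u k) : S[X]ˣ) : S[X]).natDegree ≤ B := hB ⟨k, rfl⟩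
  let ψ : X × Bool → S[X] := fun p =>
    ((cond p.2 (φ p.1) (φ p.1)⁻¹ : S[X]ˣ) : S[X])
  have hval : ((FreeGroup.lift φ (u k) : S[X]ˣ) : S[X]) = ((u k).toWord.map ψ).prod := by
    conv_lhs => rw [← FreeGroup.mk_toWord (x := u k), FreeGroup.lift_mk]
    rw [← Units.coeHom_apply, map_list_prod, List.map_map]
    rfl
  have hψinv : ∀ x, ψ (x, false) =
      1 + C (-c x) * Polynomial.X + C (b x) * Polynomial.X ^ 2 := fun x => by
    rw [C_neg, neg_mul, ← sub_eq_add_neg]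
    rfl
  have hdeg : ∀ p, (ψ p).natDegree ≤ 2 := by
    rintro ⟨x, _ | _⟩
    · rw [hψinv]
      exact natDegree_quadraticUnit_le _ _
    · exact natDegree_quadraticUnit_le _ _
  have hcoeff : ∀ p, (ψ p).coeff 2 = cond p.2 (a p.1) (b p.1) := by
    rintro ⟨x, _ | _⟩
    · rw [hψinv]
      exact coeff_two_quadraticUnit _ _
    · exact coeff_two_quadraticUnit _ _
  have hlead : (((u k).toWord.map ψ).prod).coeff ((u k).toWord.length * 2) ≠ 0 := by
    have := coeff_list_prod_of_natDegree_le ((u k).toWord.map ψ) 2 fun p hp => by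
      obtain ⟨q, -, rfl⟩ := List.mem_map.1 hp
      exact hdeg q
    rw [List.length_map, List.map_map] at this
    rw [this]
    convert hprod k using 4
    exact hcoeff _
  have := le_natDegree_of_ne_zero hlead
  rw [← hval] at this
  simp only
  omega

end Representation

/-! ### Projections onto lines in the plane -/

section Projections

open Matrix

/-- The vectors `(1, s)` and `(-s, 1)`, attached to a letter and to its inverse. -/
def letterVec (s : ℝ) (ε : Bool) : Fin 2 → ℝ :=
  cond ε ![1, s] ![-s, 1]

/-- The orthogonal projection of `ℝ²` onto the line spanned by `letterVec s ε`. -/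
noncomputable def letterProj (s : ℝ) (ε : Bool) : Matrix (Fin 2) (Fin 2) ℝ :=
  (1 + s ^ 2)⁻¹ • vecMulVec (letterVec s ε) (letterVec s ε)

/-- The reflection of `ℝ²` that interchanges the directions of `(1, s)` and `(-s, 1)`. -/
noncomputable def letterSwap (s : ℝ) : Matrix (Fin 2) (Fin 2) ℝ :=
  (1 + s ^ 2)⁻¹ • !![-2 * s, 1 - s ^ 2; 1 - s ^ 2, 2 * s]

theorem letterProj_true (s : ℝ) : letterProj s true = (1 + s ^ 2)⁻¹ • !![1, s; s, s ^ 2] := by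
  ext i j
  fin_cases i <;> fin_cases j <;> simp [letterProj, letterVec, pow_two]

theorem letterProj_false (s : ℝ) : letterProj s false = (1 + s ^ 2)⁻¹ • !![s ^ 2, -s; -s, 1] := by
  ext i j
  fin_cases i <;> fin_cases j <;> simp [letterProj, letterVec, pow_two]

theorem letterSwap_mul_self (s : ℝ) :
    letterSwap s * letterSwap s = letterProj s true + letterProj s false := by
  have : 1 + s ^ 2 ≠ 0 := by positivity
  rw [letterSwap, letterProj_true, letterProj_false]
  ext i j
  fin_cases i <;> fin_cases j <;> simp [mul_apply, Fin.sum_univ_two] <;> field_simp <;> ring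

theorem letterSwap_mul_letterProj (s : ℝ) (ε : Bool) :
    letterSwap s * letterProj s ε = letterProj s (!ε) * letterSwap s := by
  have : 1 + s ^ 2 ≠ 0 := by positivity
  cases ε <;> simp only [Bool.not_true, Bool.not_false] <;>
    rw [letterSwap, letterProj_true, letterProj_false] <;>
    ext i j <;>
    fin_cases i <;> fin_cases j <;> simp [mul_apply, Fin.sum_univ_two] <;> field_simp <;> ring

theorem letterProj_mul_letterProj_not (s : ℝ) (ε : Bool) :
    letterProj s ε * letterProj s (!ε) = 0 := by
  cases ε <;> simp only [Bool.not_true, Bool.not_false] <;>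
    rw [letterProj_true, letterProj_false] <;>
    ext i j <;>
    fin_cases i <;> fin_cases j <;> simp [mul_apply, Fin.sum_univ_two] <;> ring_nf

/-- For positive parameters, `letterVec s ε` and `letterVec t δ` are orthogonal only if they belong
to a letter and its inverse. -/
theorem letterVec_dotProduct_ne_zero {s t : ℝ} (hs : 0 < s) (ht : 0 < t) {ε δ : Bool}
    (h : s = t → ε = δ) : letterVec s ε ⬝ᵥ letterVec t δ ≠ 0 := by
  have hst : 0 < s * t := mul_pos hs ht
  cases ε <;> cases δ <;> simp [letterVec, dotProduct, Fin.sum_univ_two] at h ⊢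
  · positivity
  · exact fun h' => h (by linarith)
  · exact fun h' => h (by linarith)
  · positivity

theorem continuous_letterProj (ε : Bool) : Continuous fun s => letterProj s ε := by
  have : ∀ s : ℝ, 1 + s ^ 2 ≠ 0 := fun s => by positivity
  refine continuous_matrix fun i j => ?_
  cases ε <;> fin_cases i <;> fin_cases j <;>
    simp [letterProj, letterVec] <;> fun_prop (disch := assumption)

theorem continuous_letterSwap : Continuous letterSwap := by
  have : ∀ s : ℝ, 1 + s ^ 2 ≠ 0 := fun s => by positivity
  refine continuous_matrix fun i j => ?_
  fin_cases i <;> fin_cases j <;> simp [letterSwap] <;> fun_prop (disch := assumption)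

/-- A product of projections onto lines does not vanish if no two consecutive lines are
orthogonal. -/
theorem prod_letterProj_ne_zero {X : Type*} {s : X → ℝ} (hs : ∀ x, 0 < s x)
    {l : List (X × Bool)} (hl : l.IsChain fun p q => s p.1 = s q.1 → p.2 = q.2) :
    (l.map fun p => letterProj (s p.1) p.2).prod ≠ 0 := by
  have hv : ∀ p : X × Bool, letterVec (s p.1) p.2 ≠ 0 := fun p h =>
    letterVec_dotProduct_ne_zero (hs p.1) (hs p.1) (fun _ => rfl : s p.1 = s p.1 → p.2 = p.2)
      (by rw [h, zero_dotProduct])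
  have hpos : ∀ p : X × Bool, (1 + s p.1 ^ 2)⁻¹ ≠ 0 := fun p => by positivity
  suffices h : ∀ (l : List (X × Bool)) (p : X × Bool),
      (p :: l).IsChain (fun p q => s p.1 = s q.1 → p.2 = q.2) →
      ∃ w : Fin 2 → ℝ, w ≠ 0 ∧ ((p :: l).map fun p => letterProj (s p.1) p.2).prod =
        vecMulVec (letterVec (s p.1) p.2) w by
    cases l with
    | nil => simp
    | cons p l =>
      obtain ⟨w, hw, h⟩ := h l p hl
      rw [h]
      exact vecMulVec_ne_zero (hv p) hw
  intro l
  induction l with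
  | nil =>
    intro p _
    exact ⟨_, smul_ne_zero (hpos p) (hv p), by simp [letterProj, vecMulVec_smul]⟩
  | cons q l ih =>
    intro p hp
    rw [List.isChain_cons_cons] at hp
    obtain ⟨w, hw, h⟩ := ih q hp.2
    refine ⟨((1 + s p.1 ^ 2)⁻¹ * (letterVec (s p.1) p.2 ⬝ᵥ letterVec (s q.1) q.2)) • w,
      smul_ne_zero (mul_ne_zero (hpos p)
        (letterVec_dotProduct_ne_zero (hs _) (hs _) hp.1)) hw, ?_⟩
    rw [List.map_cons, List.prod_cons, h, letterProj, smul_mul_assoc, vecMulVec_mul_vecMulVec,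
      mul_smul, vecMulVec_smul, vecMulVec_smul, vecMulVec_smul]

end Projections

/-! ### Bounded continuous functions on Tychonoff spaces -/

section Separation

open BoundedContinuousFunction

variable {X : Type*} [TopologicalSpace X] [T35Space X]

/-- By the Baire category theorem, a countable set of points is separated by a single bounded
continuous function. -/
theorem exists_boundedContinuousFunction_injOn {D : Set X} (hD : D.Countable) :
    ∃ f : X →ᵇ ℝ, Set.InjOn f D := by
  let V : X × X → Submodule ℝ (X →ᵇ ℝ) := fun p =>
    LinearMap.ker ((evalCLM ℝ p.1 - evalCLM ℝ p.2 : (X →ᵇ ℝ) →L[ℝ] ℝ) : (X →ᵇ ℝ) →ₗ[ℝ] ℝ)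
  have hmem : ∀ p f, f ∈ V p ↔ f p.1 = f p.2 := fun p f => by
    simp [V, sub_eq_zero]
  have hopen : ∀ p, IsOpen ((V p : Set (X →ᵇ ℝ))ᶜ) := fun p =>
    (ContinuousLinearMap.isClosed_ker
      (evalCLM ℝ p.1 - evalCLM ℝ p.2 : (X →ᵇ ℝ) →L[ℝ] ℝ)).isOpen_compl
  have hdense : ∀ p ∈ D.offDiag, Dense ((V p : Set (X →ᵇ ℝ))ᶜ) := by
    rintro ⟨x, y⟩ ⟨-, -, hxy⟩
    rw [← interior_eq_empty_iff_dense_compl]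
    by_contra hne
    have htop := (V (x, y)).eq_top_of_nonempty_interior' (Set.nonempty_iff_ne_empty.2 hne)
    obtain ⟨f, hf, hfx, hfy⟩ := CompletelyRegularSpace.completely_regular x {y}
      isClosed_singleton hxy
    let g : X →ᵇ ℝ := BoundedContinuousFunction.ofNormedAddCommGroup (fun x => (f x : ℝ))
      (by fun_prop) 1 fun x => by simpa [abs_of_nonneg (f x).2.1] using (f x).2.2
    have hg : g ∈ V (x, y) := htop ▸ Submodule.mem_top
    rw [hmem] at hg
    have h1 : f y = 1 := hfy rfl
    simp [g, hfx, h1] at hg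
  have hcount : D.offDiag.Countable := (hD.prod hD).mono fun p hp =>
    Set.mem_prod.2 ⟨hp.1, hp.2.1⟩
  obtain ⟨f, hf⟩ := (dense_biInter_of_isOpen (fun p _ => hopen p) hcount hdense).nonempty
  refine ⟨f, fun x hx y hy hxy => ?_⟩
  by_contra hne
  exact Set.mem_iInter₂.1 hf (x, y) ⟨hx, hy, hne⟩ ((hmem _ _).2 hxy)

/-- A function bounded by `1` on a finite set of points is interpolated there by a continuous
function bounded by `1`. -/
theorem exists_boundedContinuousFunction_eqOn (s : Finset X) (r : X → ℝ)
    (hr : ∀ x ∈ s, |r x| ≤ 1) : ∃ f : X →ᵇ ℝ, ‖f‖ ≤ 1 ∧ ∀ x ∈ s, f x = r x := by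
  classical
  have hsep : ∀ x : X, ∃ f : X → unitInterval, Continuous f ∧ f x = 0 ∧
      Set.EqOn f 1 (s.erase x : Finset X) := fun x =>
    CompletelyRegularSpace.completely_regular x _ (s.erase x).finite_toSet.isClosed (by simp)
  choose f hf hfx hf1 using hsep
  -- Truncation to `[-1, 1]` keeps the prescribed values.
  let g : X → ℝ := fun y => max (-1) (min 1 (∑ x ∈ s, r x * (1 - f x y)))
  have hg : ∀ y, ‖g y‖ ≤ 1 := fun y => by
    rw [Real.norm_eq_abs, abs_le]
    exact ⟨le_max_left _ _, max_le (by norm_num) (min_le_left _ _)⟩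
  refine ⟨BoundedContinuousFunction.ofNormedAddCommGroup g (by fun_prop) 1 hg,
    BoundedContinuousFunction.norm_ofNormedAddCommGroup_le _ zero_le_one hg, fun y hy => ?_⟩
  have hsum : ∑ x ∈ s, r x * (1 - (f x y : ℝ)) = r y := by
    rw [Finset.sum_eq_single_of_mem y hy]
    · simp [hfx]
    · intro x hx hxy
      have : f x y = 1 := hf1 x (by simp [hy, hxy.symm])
      simp [this]
  change max (-1) (min 1 (∑ x ∈ s, r x * (1 - (f x y : ℝ)))) = r y
  rw [hsum, min_eq_right (abs_le.1 (hr y hy)).2, max_eq_right (abs_le.1 (hr y hy)).1]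

/-! ### Lengths along convergent sequences in `F(X)` -/

/-- The representation by quadratic units is applied to the projections of the parameters
`exp (f x)`, where `f` separates the countably many letters of the sequence: then the adjacent
letters of a reduced word give nonorthogonal lines. -/
theorem bddAbove_length_of_tendsto_freeGroup [DecidableEq X] {u : ℕ → FreeGroup X}
    {z : FreeGroup X} (hu : Tendsto u atTop (𝓝 z)) :
    BddAbove (Set.range fun k => (u k).toWord.length) := by
  let D : Set X := ⋃ k, {x | ∃ p ∈ (u k).toWord, p.1 = x}
  have hD : D.Countable := Set.countable_iUnion fun k =>
    (((u k).toWord.toFinset.finite_toSet.image Prod.fst).subset (by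
      rintro _ ⟨p, hp, rfl⟩
      exact ⟨p, by simpa using hp, rfl⟩)).countable
  obtain ⟨f, hf⟩ := exists_boundedContinuousFunction_injOn hD
  -- The exponential makes the parameters positive, so that equal signs never give orthogonal lines.
  let s : X → ℝ := fun x => Real.exp (f x)
  have hs : Continuous s := by fun_prop
  let _ : NormedRing (Matrix (Fin 2) (Fin 2) ℝ) := Matrix.linftyOpNormedRing
  refine bddAbove_length_of_quadraticUnit (a := fun x => letterProj (s x) true)
    (b := fun x => letterProj (s x) false) (c := fun x => letterSwap (s x))
    ((continuous_letterProj true).comp hs) ((continuous_letterProj false).comp hs)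
    (continuous_letterSwap.comp hs) (fun x => letterSwap_mul_self _)
    (fun x => letterSwap_mul_letterProj _ false) (fun x => letterSwap_mul_letterProj _ true)
    (fun x => letterProj_mul_letterProj_not _ true)
    (fun x => letterProj_mul_letterProj_not _ false) hu fun k => ?_
  have hchain : (u k).toWord.IsChain fun p q => s p.1 = s q.1 → p.2 = q.2 := by
    have hred : (u k).toWord.IsChain fun p q => p.1 = q.1 → p.2 = q.2 :=
      FreeGroup.isReduced_toWord
    refine List.IsChain.imp_of_mem_imp (fun p q hp hq h hpq => h ?_) hred
    exact hf (Set.mem_iUnion.2 ⟨k, p, hp, rfl⟩) (Set.mem_iUnion.2 ⟨k, q, hq, rfl⟩)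
      (Real.exp_injective hpq)
  have hcond : (fun p : X × Bool =>
      cond p.2 (letterProj (s p.1) true) (letterProj (s p.1) false)) =
      fun p => letterProj (s p.1) p.2 := by
    funext ⟨x, ε⟩
    cases ε <;> rfl
  rw [hcond]
  exact prod_letterProj_ne_zero (fun x => Real.exp_pos (f x)) hchain

end Separation

/-! ### Lengths along convergent sequences in `A(X)` -/

section FreeAbelian

open BoundedContinuousFunction

variable {X : Type*}

/-- The length `∑ |kₓ|` of the element `∑ kₓ x` of the free Abelian group. -/
noncomputable def FreeAbelianGroup.length (g : FreeAbelianGroup X) : ℕ :=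
  (FreeAbelianGroup.toFinsupp g).sum fun _ k => k.natAbs

theorem FreeAbelianGroup.le_length_nsmul (g : FreeAbelianGroup X) (m : ℕ) (hg : g ≠ 0) :
    m ≤ (m • g).length := by
  have hne : FreeAbelianGroup.toFinsupp g ≠ 0 := fun h =>
    hg ((FreeAbelianGroup.equivFinsupp X).map_eq_zero_iff.1 h)
  obtain ⟨x, hx⟩ := Finsupp.ne_iff.1 hne
  rcases Nat.eq_zero_or_pos m with rfl | hm
  · exact Nat.zero_le _
  have hpos : 1 ≤ (FreeAbelianGroup.toFinsupp g x).natAbs := Int.natAbs_pos.2 hx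
  have hmem : x ∈ (m • FreeAbelianGroup.toFinsupp g).support := by
    simpa [hm.ne'] using hx
  calc m ≤ m * (FreeAbelianGroup.toFinsupp g x).natAbs := Nat.le_mul_of_pos_right _ hpos
    _ = ((m • FreeAbelianGroup.toFinsupp g) x).natAbs := by simp [Int.natAbs_mul]
    _ ≤ _ := by
      rw [FreeAbelianGroup.length, map_nsmul]
      exact Finset.single_le_sum (f := fun y => ((m • FreeAbelianGroup.toFinsupp g) y).natAbs)
        (fun _ _ => Nat.zero_le _) hmem

theorem FreeAbelianGroup.lift_eq_sum_toFinsupp (f : X → ℝ) (g : FreeAbelianGroup X) :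
    FreeAbelianGroup.lift f g = (FreeAbelianGroup.toFinsupp g).sum fun x k => k * f x := by
  induction g using FreeAbelianGroup.induction_on with
  | zero => simp
  | of x => simp
  | neg x h => simp [Finsupp.sum_neg_index]
  | add a b ha hb =>
    rw [map_add, map_add, ha, hb, Finsupp.sum_add_index'] <;> intros <;> simp [add_mul]

variable [TopologicalSpace X]

/-- The evaluation of an element of `A(X)` as a measure of finite support: the functional
`f ↦ ∑ kₓ f(x)` on the bounded continuous functions. -/
noncomputable def FreeAbelianGroup.evalFunctional (g : FreeAbelianGroup X) : (X →ᵇ ℝ) →L[ℝ] ℝ :=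
  (FreeAbelianGroup.toFinsupp g).sum fun x k => (k : ℝ) • evalCLM ℝ x

theorem FreeAbelianGroup.evalFunctional_apply (g : FreeAbelianGroup X) (f : X →ᵇ ℝ) :
    g.evalFunctional f = FreeAbelianGroup.lift f g := by
  rw [lift_eq_sum_toFinsupp, evalFunctional, Finsupp.sum, Finsupp.sum, _root_.sum_apply]
  rfl

variable [T35Space X]

/-- The norm of a finitely supported measure is its total variation. -/
theorem FreeAbelianGroup.length_le_norm_evalFunctional (g : FreeAbelianGroup X) :
    (g.length : ℝ) ≤ ‖g.evalFunctional‖ := by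
  obtain ⟨f, hf, hfs⟩ := exists_boundedContinuousFunction_eqOn
    (FreeAbelianGroup.toFinsupp g).support
    (fun x => ((FreeAbelianGroup.toFinsupp g x).sign : ℝ)) fun x hx => by
      have := Finsupp.mem_support_iff.1 hx
      rcases lt_or_gt_of_ne this with h | h
      · simp [Int.sign_eq_neg_one_of_neg h]
      · simp [Int.sign_eq_one_of_pos h]
  have hval : g.evalFunctional f = g.length := by
    rw [evalFunctional_apply, lift_eq_sum_toFinsupp, length, Finsupp.sum, Finsupp.sum]
    push_cast
    refine Finset.sum_congr rfl fun x hx => ?_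
    rw [hfs x hx, Nat.cast_natAbs]
    exact_mod_cast Int.mul_sign_self _
  calc (g.length : ℝ) ≤ ‖g.evalFunctional f‖ := by rw [hval]; exact le_abs_self _
    _ ≤ ‖g.evalFunctional‖ * ‖f‖ := g.evalFunctional.le_opNorm f
    _ ≤ ‖g.evalFunctional‖ := mul_le_of_le_one_right (by positivity) hf

/-- A convergent sequence gives pointwise convergent, hence pointwise bounded, functionals; by the
uniform boundedness principle their norms are bounded. -/
theorem bddAbove_length_of_tendsto_freeAbelianGroup {u : ℕ → FreeAbelianGroup X}
    {z : FreeAbelianGroup X} (hu : Tendsto u atTop (𝓝 z)) :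
    BddAbove (Set.range fun k => (u k).length) := by
  obtain ⟨B, hB⟩ := banach_steinhaus (g := fun k => (u k).evalFunctional) fun f => by
    have hlim : Tendsto (fun k => FreeAbelianGroup.lift f (u k)) atTop
        (𝓝 (FreeAbelianGroup.lift f z)) :=
      ((continuous_freeAbelianGroup_lift f.continuous).tendsto z).comp hu
    obtain ⟨B, hB⟩ := hlim.norm.bddAbove_range
    exact ⟨B, fun k => by
      rw [FreeAbelianGroup.evalFunctional_apply]
      exact hB ⟨k, rfl⟩⟩
  refine ⟨⌊B⌋₊, ?_⟩
  rintro _ ⟨k, rfl⟩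
  exact Nat.le_floor ((u k).length_le_norm_evalFunctional.trans (hB k))

end FreeAbelian

theorem theorem3p1 (X : Type*) [TopologicalSpace X] [T35Space X] :
    [SnfCountable (FreeGroup X),
      ∀ n : ℕ, 1 ≤ n → ¬ HasNontrivialConvergentSeq (freeGroupBall X n),
      ¬ HasNontrivialConvergentSeq (FreeGroup X)].TFAE ∧
    [SnfCountable (FreeAbelianGroup X),
      ∀ n : ℕ, 1 ≤ n → ¬ HasNontrivialConvergentSeq (freeAbelianGroupBall X n),
      ¬ HasNontrivialConvergentSeq (FreeAbelianGroup X)].TFAE := by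
  classical
  constructor
  · tfae_have 3 → 1 := snfCountable_of_not_hasNontrivialConvergentSeq
    tfae_have 3 → 2 := fun h n _ hn => h (hasNontrivialConvergentSeq_of_subtype hn)
    tfae_have 1 → 3 := not_hasNontrivialConvergentSeq_of_snfCountable
      (ℓ := fun g => g.toWord.length) (fun _ _ => bddAbove_length_of_tendsto_freeGroup)
      FreeGroup.le_length_toWord_pow
    tfae_have 2 → 3 := not_hasNontrivialConvergentSeq_of_balls
      (fun _ _ => bddAbove_length_of_tendsto_freeGroup)
    tfae_finish
  · tfae_have 3 → 1 := snfCountable_of_not_hasNontrivialConvergentSeq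
    tfae_have 3 → 2 := fun h n _ hn => h (hasNontrivialConvergentSeq_of_subtype hn)
    tfae_have 1 → 3 := not_hasNontrivialConvergentSeq_of_snfCountable_add
      (ℓ := FreeAbelianGroup.length) (fun _ _ => bddAbove_length_of_tendsto_freeAbelianGroup)
      FreeAbelianGroup.le_length_nsmul
    tfae_have 2 → 3 := not_hasNontrivialConvergentSeq_of_balls
      (fun _ _ => bddAbove_length_of_tendsto_freeAbelianGroup)
    tfae_finish
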